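/- Let $\beta,R>0$. Let $\lfloor\beta\rfloor$ denote the largest integer strictly smaller than $\beta$, put $\|f\|_{\mathscr C^\beta}=\sum_{\ell\le\lfloor\beta\rfloor}\sup_{[0,1]}|f^{(\ell)}|+\sup_{x\ne y\in[0,1]}\frac{|f^{(\lfloor\beta\rfloor)}(x)-f^{(\lfloor\beta\rfloor)}(y)|}{|x-y|^{\beta-\lfloor\beta\rfloor}}$, and let $\mathscr C^\beta(R)$ be the set of all $\lfloor\beta\rfloor$ times differentiable $f:[0,1]\to\mathbb R$ with $\|f\|_{\mathscr C^\beta}\le R$. For $n\in\mathbb N$ and $f\in\mathscr C^\beta(R)$ let $P_f$ be the law of the path $Y=(Y_x)_{x\in[0,1]}$ in the Gaussian white noise model $$dY_x=f(x)\,dx+n^{-1/2}\,dW_x,\qquad Y_0=0,$$ where $W$ is a standard Brownian motion, and let $E_f$ be the expectation under $P_f$. **Theorem.** For all $\beta,R,C>0$ there are constants $c=c(\beta,C,R)>0$ and $N=N(\beta,C,R)$ such that for every $n\ge N$, every $x_0\in[0,1]$ and every (measurable) estimator $\widehat f(x_0)=\widehat f(x_0)(Y)$ of $f(x_0)$ the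 following two statements hold. (a) If $E_f|\widehat f(x_0)|<\infty$ for all $f\in\mathscr C^\beta(R)$ and $$\sup_{f\in\mathscr C^\beta(R)}\big|E_f[\widehat f(x_0)]-f(x_0)\big|<\Big(\frac Cn\Big)^{\beta/(2\beta+1)},$$ then $$\sup_{f\in\mathscr C^\beta(R)}E_f\big[\big|\widehat f(x_0)-E_f[\widehat f(x_0)]\big|\big]\ \ge\ c\,n^{-\beta/(2\beta+1)}.$$ (b) If $\operatorname{Med}_f[\widehat f(x_0)]$ denotes, for each $f\in\mathscr C^\beta(R)$, any median of $\widehat f(x_0)$ under $P_f$, and $$\sup_{f\in\mathscr C^\beta(R)}\big|\operatorname{Med}_f[\widehat f(x_0)]-f(x_0)\big|<\Big(\frac Cn\Big)^{\beta/(2\beta+1)},$$ then $$\sup_{f\in\mathscr C^\beta(R)}E_f\big[\big|\widehat f(x_0)-\operatorname{Med}_f[\widehat f(x_0)]\big|\big]\ \ge\ c\,n^{-\beta/(2\beta+1)}$$ (the left-hand side may be $+\infty$). -/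

import Mathlib

open MeasureTheory ProbabilityTheory
open scoped NNReal ENNReal

/-- The largest integer that is strictly smaller than `β` (for `β > 0`). -/
noncomputable def strictFloor (β : ℝ) : ℕ := ⌈β⌉₊ - 1

/-- The `β`-Hölder norm of a function on `[0,1]`, with value `∞` allowed:
the sum of the sup-norms of the derivatives up to order `k`, plus the `(β - k)`-Hölder seminorm of
the `k`-th derivative, where `k` is the largest integer strictly smaller than `β`.
Only the values of `f` on `[0,1]` matter: derivatives are taken within `[0,1]`. -/
noncomputable def holderNorm (β : ℝ) (f : ℝ → ℝ) : ℝ≥0∞ :=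
  (∑ l ∈ Finset.range (strictFloor β + 1),
    ⨆ x ∈ Set.Icc (0 : ℝ) 1, ENNReal.ofReal |iteratedDerivWithin l f (Set.Icc 0 1) x|) +
  ⨆ x ∈ Set.Icc (0 : ℝ) 1, ⨆ y ∈ Set.Icc (0 : ℝ) 1, ⨆ _ : x ≠ y,
    ENNReal.ofReal
      (|iteratedDerivWithin (strictFloor β) f (Set.Icc 0 1) x -
          iteratedDerivWithin (strictFloor β) f (Set.Icc 0 1) y| /
        |x - y| ^ (β - (strictFloor β : ℝ)))

/-- The ball of radius `R` of `β`-Hölder functions on `[0,1]`: the derivatives in the norm exist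
(the last one is continuous as soon as the norm is finite) and the norm is at most `R`.
A function on `[0,1]` is represented by any of its extensions to `ℝ`. -/
def holderBall (β R : ℝ) : Set (ℝ → ℝ) :=
  {f | ContDiffOn ℝ (strictFloor β) f (Set.Icc 0 1) ∧ holderNorm β f ≤ ENNReal.ofReal R}

/-- The observed path `Y_x = ∫₀ˣ f(t) dt + n^{-1/2} W_x`, `x ∈ [0,1]`, i.e.
`dY_x = f(x) dx + n^{-1/2} dW_x`, `Y_0 = 0`, where `W` is the driving process. -/
noncomputable def whiteNoisePath {Ω : Type*} (W : ℝ≥0 → Ω → ℝ) (n : ℕ) (f : ℝ → ℝ) (ω : Ω) :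
    Set.Icc (0 : ℝ) 1 → ℝ :=
  fun x => (∫ t in (0 : ℝ)..(x : ℝ), f t) + (n : ℝ) ^ (-(1 / 2) : ℝ) * W ⟨x, x.2.1⟩ ω

/-- The law `P_f` of the observed path, on the path space `ℝ^[0,1]` with the σ-algebra generated by
the coordinates. -/
noncomputable def whiteNoiseLaw {Ω : Type*} [MeasurableSpace Ω] (P : Measure Ω)
    (W : ℝ≥0 → Ω → ℝ) (n : ℕ) (f : ℝ → ℝ) : Measure (Set.Icc (0 : ℝ) 1 → ℝ) :=
  P.map (whiteNoisePath W n f)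

/-- The bias `E_μ T - θ` of `T` as an estimator of the value `θ`. -/
noncomputable def bias {S : Type*} [MeasurableSpace S] (μ : Measure S) (T : S → ℝ) (θ : ℝ) : ℝ :=
  (∫ y, T y ∂μ) - θ

/-- The mean absolute deviation `E_μ |T - u|` of `T` from the centre `u`, with value `∞` allowed. -/
noncomputable def meanAbsDev {S : Type*} [MeasurableSpace S] (μ : Measure S) (T : S → ℝ) (u : ℝ) :
    ℝ≥0∞ :=
  ∫⁻ y, ENNReal.ofReal |T y - u| ∂μ

/-- `m` is a median of `T` under the probability measure `μ`. -/
def IsMedian {S : Type*} [MeasurableSpace S] (μ : Measure S) (T : S → ℝ) (m : ℝ) : Prop :=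
  1 / 2 ≤ μ {y | T y ≤ m} ∧ 1 / 2 ≤ μ {y | m ≤ T y}

/-! This is a two-point argument. Compare drift `0` with a bump `f` at `x₀` of width of order
`n^(-1/(2β+1))` and height `(2 C^r + 1) n^(-r)`, where `r = β/(2β+1)`. A centre within `(C/n)^r` of
the true value under both drifts must move by at least `n^(-r)` between them. Mean and median enter
only through this closeness, so one bound serves both statements.

Since `n ∫ f²` does not depend on `n`, the laws satisfy `P_f(S)² ≤ K P_0(S)` with `K` fixed
(`whiteNoiseLaw_sq_le`). Hence the estimator cannot concentrate near two separated centres under the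
two laws (`le_max_meanAbsDev`).

The domination replaces Girsanov's theorem by a finite-dimensional argument. At finitely many times
the drift is the covariance of the process with a linear functional `Z` of it, and shifting by that
covariance only translates `Z` (`sq_measure_shift_le`). The variance of `Z` is at most `n ∫ f²` by
an `L²` projection, so the bound is uniform over cylinder sets and passes to all measurable sets. -/

/-! ### Change of measure for a shifted Gaussian process -/

lemma gaussianReal_translate_eq_withDensity {v : ℝ≥0} (hv : v ≠ 0) :
    gaussianReal v v =
      (gaussianReal 0 v).withDensity fun z ↦ ENNReal.ofReal (Real.exp (z - v / 2)) := by
  rw [gaussianReal_of_var_ne_zero _ hv, gaussianReal_of_var_ne_zero _ hv,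
    ← withDensity_mul _ (measurable_gaussianPDF _ _) (by fun_prop)]
  congr 1
  ext z
  have hv' : (v : ℝ) ≠ 0 := by exact_mod_cast hv
  rw [Pi.mul_apply, gaussianPDF, gaussianPDF, ← ENNReal.ofReal_mul (gaussianPDFReal_nonneg _ _ _),
    gaussianPDFReal, gaussianPDFReal, mul_assoc (√(2 * Real.pi * v))⁻¹, ← Real.exp_add]
  congr 3
  field_simp
  ring

/-- Cauchy–Schwarz against the constant `1` on `s`; with `g` a density, it turns a second moment
into a domination of measures. -/
lemma sq_setLIntegral_le {α : Type*} [MeasurableSpace α] (μ : Measure α) (s : Set α)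
    {g : α → ℝ≥0∞} (hg : AEMeasurable g μ) :
    (∫⁻ x in s, g x ∂μ) ^ 2 ≤ μ s * ∫⁻ x, g x ^ 2 ∂μ := by
  have h := ENNReal.lintegral_mul_le_Lp_mul_Lq (μ.restrict s) Real.HolderConjugate.two_two
    (f := 1) (g := g) aemeasurable_const hg.restrict
  simp only [Pi.mul_apply, Pi.one_apply, one_mul, ENNReal.rpow_two, one_pow, lintegral_one,
    Measure.restrict_apply_univ] at h
  calc _ ≤ ((μ s) ^ (1 / 2 : ℝ) * (∫⁻ x in s, g x ^ 2 ∂μ) ^ (1 / 2 : ℝ)) ^ 2 := by gcongr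
    _ = μ s * ∫⁻ x in s, g x ^ 2 ∂μ := by
      rw [← ENNReal.mul_rpow_of_nonneg _ _ (by norm_num), ← ENNReal.rpow_two, ← ENNReal.rpow_mul]
      norm_num
    _ ≤ _ := by gcongr; exact Measure.restrict_le_self

lemma lintegral_sq_exp_gaussianReal (v : ℝ≥0) :
    ∫⁻ z, ENNReal.ofReal (Real.exp (z - v / 2)) ^ 2 ∂(gaussianReal 0 v) =
      ENNReal.ofReal (Real.exp v) := by
  have h1 : ∀ z : ℝ, ENNReal.ofReal (Real.exp (z - v / 2)) ^ 2 =
      ENNReal.ofReal (Real.exp (-v)) * ENNReal.ofReal (Real.exp (2 * z)) := by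
    intro z
    rw [← ENNReal.ofReal_pow (Real.exp_pos _).le, ← ENNReal.ofReal_mul (Real.exp_pos _).le,
      ← Real.exp_nat_mul, ← Real.exp_add]
    congr 2
    push_cast
    ring
  simp_rw [h1]
  rw [lintegral_const_mul _ (by fun_prop), ← ofReal_integral_eq_lintegral_ofReal
    (integrable_exp_mul_gaussianReal 2) (.of_forall fun z ↦ (Real.exp_pos _).le),
    ← ENNReal.ofReal_mul (Real.exp_pos _).le]
  have := congrFun (mgf_fun_id_gaussianReal (μ := 0) (v := v)) 2
  rw [mgf] at this
  rw [this, ← Real.exp_add]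
  congr 2
  ring

/-- Shifting a Gaussian process `W` by the covariance with a centred linear functional `Z` of the
process changes its law by a density with second moment `exp (Var Z)`. -/
lemma ProbabilityTheory.IsGaussianProcess.sq_measure_shift_le {Ω T : Type*} [MeasurableSpace Ω] {P : Measure Ω}
    {W : T → Ω → ℝ} (hW : IsGaussianProcess W P) (hm : ∀ t, Measurable (W t))
    (h0 : ∀ t, P[W t] = 0) (J : Finset T) (a : T → ℝ) {S : Set (T → ℝ)} (hS : MeasurableSet S) :
    P {ω | (fun s ↦ W s ω + cov[W s, fun ω ↦ ∑ t ∈ J, a t * W t ω; P]) ∈ S} ^ 2 ≤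
      ENNReal.ofReal (Real.exp Var[fun ω ↦ ∑ t ∈ J, a t * W t ω; P]) *
        P {ω | (fun s ↦ W s ω) ∈ S} := by
  classical
  have := hW.isProbabilityMeasure
  set Z : Ω → ℝ := fun ω ↦ ∑ t ∈ J, a t * W t ω with hZ
  have hZm : Measurable Z := by fun_prop
  have hZG : IsGaussianProcess (fun (_ : Unit) ↦ Z) P :=
    hW.of_isGaussianProcess fun _ ↦ ⟨J, ∑ t : J, a t • ContinuousLinearMap.proj t, fun ω ↦ by
      simp [hZ, ← Finset.sum_attach J]⟩
  have hZL2 : MemLp Z 2 P := (hZG.hasGaussianLaw_eval ()).memLp_two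
  have hWL2 t : MemLp (W t) 2 P := (hW.hasGaussianLaw_eval t).memLp_two
  have hZ0 : P[Z] = 0 := by
    rw [hZ, integral_finsetSum _ fun t _ ↦ ((hWL2 t).integrable (by simp)).const_mul _]
    simp [integral_const_mul, h0]
  set v : ℝ≥0 := Var[Z; P].toNNReal with hv
  have hvv : Var[Z; P] = v := by rw [hv, Real.coe_toNNReal _ (variance_nonneg _ _)]
  have hZlaw : P.map Z = gaussianReal 0 v := by
    rw [(hZG.hasGaussianLaw_eval ()).map_eq_gaussianReal, hZ0]
  rw [hvv]
  set h : T → ℝ := fun s ↦ cov[W s, Z; P] with hh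
  -- In the degenerate case `Z` vanishes almost surely, so the shift is zero.
  rcases eq_or_ne v 0 with hv0 | hv0
  · have hh0 : ∀ s, h s = 0 := by
      intro s
      have h1 : Z =ᵐ[P] fun _ ↦ (0 : ℝ) := by
        have h2 : ∀ᵐ z ∂(P.map Z), z = 0 := by
          rw [hZlaw, hv0, gaussianReal_zero_var]
          exact ae_dirac_eq (a := (0 : ℝ)) ▸ rfl
        exact ae_of_ae_map hZm.aemeasurable h2
      rw [hh]
      simp only [covariance, hZ0]
      rw [integral_congr_ae (g := fun _ ↦ 0)]
      · simp
      · filter_upwards [h1] with ω hω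
        simp [hω]
    change P {ω | (fun s ↦ W s ω + h s) ∈ S} ^ 2 ≤ _
    simp only [hh0, add_zero, hv0, NNReal.coe_zero, Real.exp_zero, ENNReal.ofReal_one, one_mul]
    rw [sq]
    exact mul_le_of_le_one_left' prob_le_one
  have hv' : (v : ℝ) ≠ 0 := by exact_mod_cast hv0
  -- Residual of the regression of `W s` on `Z`: uncorrelated with `Z`, hence independent of it by
  -- joint Gaussianity. As `h s / v * v = h s`, shifting `W` by `h` translates `Z` by `v` and leaves
  -- `X` alone.
  set X : T → Ω → ℝ := fun s ω ↦ W s ω - h s / v * Z ω with hX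
  have hXm s : Measurable (X s) := by fun_prop
  have hXm' : Measurable fun ω s ↦ X s ω := measurable_pi_lambda _ hXm
  have hG : IsGaussianProcess (Sum.elim X fun _ : Unit ↦ Z) P := by
    refine hW.of_isGaussianProcess fun s ↦ ?_
    rcases s with s | u
    · refine ⟨insert s J, ContinuousLinearMap.proj ⟨s, by simp⟩ -
        (h s / v) • ∑ t : J, a t • ContinuousLinearMap.proj ⟨t.1, by simp⟩, fun ω ↦ ?_⟩
      simp [hX, hZ, ← Finset.sum_attach J]
    · exact ⟨J, ∑ t : J, a t • ContinuousLinearMap.proj t, fun ω ↦ by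
        simp [hZ, ← Finset.sum_attach J]⟩
  have hind : IndepFun (fun ω s ↦ X s ω) Z P := by
    have := hG.indepFun_of_covariance_eq_zero (fun s ↦ (hXm s).aemeasurable)
      (fun _ ↦ hZm.aemeasurable) fun s _ ↦ by
        rw [hX, covariance_fun_sub_left (hWL2 s) (hZL2.const_mul _) hZL2,
          covariance_const_mul_left, covariance_self hZm.aemeasurable, hvv]
        simp only [hh]
        field_simp
        ring
    exact this.comp (φ := id) (ψ := fun z : Unit → ℝ ↦ z ()) measurable_id (by fun_prop)
  have hpair : P.map (fun ω ↦ ((fun s ↦ X s ω), Z ω)) =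
      (P.map fun ω s ↦ X s ω).prod (gaussianReal 0 v) := by
    rw [← hZlaw]
    exact (indepFun_iff_map_prod_eq_prod_map_map hXm'.aemeasurable hZm.aemeasurable).1 hind
  set μ := P.map fun ω s ↦ X s ω
  have : IsProbabilityMeasure μ := Measure.isProbabilityMeasure_map hXm'.aemeasurable
  set G : (T → ℝ) × ℝ → T → ℝ := fun p s ↦ p.1 s + h s / v * p.2 with hGdef
  have hGm : Measurable G := by fun_prop
  have hpm : Measurable fun ω ↦ ((fun s ↦ X s ω), Z ω) := hXm'.prodMk hZm
  have e1 : P {ω | (fun s ↦ W s ω) ∈ S} = (μ.prod (gaussianReal 0 v)) (G ⁻¹' S) := by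
    rw [← hpair, Measure.map_apply hpm (hGm hS)]
    congr 1
    ext ω
    simp [hGdef, hX]
  have e2 : P {ω | (fun s ↦ W s ω + h s) ∈ S} = (μ.prod (gaussianReal v v)) (G ⁻¹' S) := by
    have : gaussianReal v v = (gaussianReal 0 v).map (· + (v : ℝ)) := by
      rw [gaussianReal_map_add_const, zero_add]
    have h1 : μ.prod (gaussianReal v v) =
        (μ.prod (gaussianReal 0 v)).map (Prod.map id (· + (v : ℝ))) := by
      rw [this, ← Measure.map_prod_map _ _ measurable_id (by fun_prop), Measure.map_id]
    rw [h1, Measure.map_apply (by fun_prop) (hGm hS), ← hpair,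
      Measure.map_apply hpm ((by fun_prop : Measurable (Prod.map id (· + (v : ℝ)))) (hGm hS))]
    congr 1
    ext ω
    simp only [hGdef, hX, Set.mem_ofPred_eq, Set.mem_preimage, Prod.map, id]
    congr! 2 with s
    field_simp
    ring
  change P {ω | (fun s ↦ W s ω + h s) ∈ S} ^ 2 ≤ _
  rw [e1, e2, gaussianReal_translate_eq_withDensity hv0, prod_withDensity_right (by fun_prop),
    withDensity_apply _ (hGm hS), mul_comm]
  refine (sq_setLIntegral_le _ _ (by fun_prop)).trans_eq ?_
  congr 1
  rw [lintegral_prod _ (by fun_prop)]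
  simp [lintegral_sq_exp_gaussianReal]

/-! ### Chi-square domination of the white noise laws -/

/-- The `L²` projection of `f` onto the span of the indicators of `(0, t]`, `t ∈ J`, in
coordinates. -/
lemma exists_sum_min_eq_integral {f : ℝ → ℝ} (hf : MemLp f 2 volume)
    (J : Finset (Set.Icc (0 : ℝ) 1)) :
    ∃ a : Set.Icc (0 : ℝ) 1 → ℝ,
      (∀ s ∈ J, ∑ t ∈ J, a t * min (s : ℝ) t = ∫ x in (0 : ℝ)..s, f x) ∧
      ∑ s ∈ J, ∑ t ∈ J, a s * a t * min (s : ℝ) t ≤ ∫ x, f x ^ 2 := by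
  classical
  let e : Set.Icc (0 : ℝ) 1 → Lp ℝ 2 (volume : Measure ℝ) := fun t ↦
    indicatorConstLp 2 (measurableSet_Ioc (a := 0) (b := (t : ℝ))) (by simp) (1 : ℝ)
  have he : ∀ s t, inner ℝ (e s) (e t) = min (s : ℝ) t := by
    intro s t
    simp only [e]
    rw [L2.real_inner_indicatorConstLp_one_indicatorConstLp_one measurableSet_Ioc
      measurableSet_Ioc (by simp) (by simp), Set.Ioc_inter_Ioc, Real.volume_real_Ioc]
    simp [s.2.1, t.2.1]
  have hef : ∀ s, inner ℝ (e s) (hf.toLp f) = ∫ x in (0 : ℝ)..s, f x := by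
    intro s
    simp only [e]
    rw [L2.inner_indicatorConstLp_one, intervalIntegral.integral_of_le s.2.1]
    exact integral_congr_ae (ae_restrict_of_ae hf.coeFn_toLp)
  -- Projecting onto `U` preserves inner products with each `e s`, which gives the equations, and
  -- does not increase the norm, which gives the inequality.
  let U : Submodule ℝ (Lp ℝ 2 (volume : Measure ℝ)) := Submodule.span ℝ (e '' J)
  have : FiniteDimensional ℝ U := FiniteDimensional.span_of_finite ℝ (J.finite_toSet.image e)
  have hmem : U.starProjection (hf.toLp f) ∈ U := Submodule.starProjection_apply_mem _ _
  obtain ⟨a, ha⟩ := (Submodule.mem_span_image_finset_iff_exists_fun' ℝ).1 hmem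
  refine ⟨a, fun s hs ↦ ?_, ?_⟩
  · rw [← hef s]
    have hsU : e s ∈ U := Submodule.subset_span ⟨s, hs, rfl⟩
    have h1 : inner ℝ (e s) (hf.toLp f) = inner ℝ (e s) (U.starProjection (hf.toLp f)) := by
      conv_lhs => rw [← Submodule.starProjection_eq_self_iff.2 hsU]
      exact Submodule.inner_starProjection_left_eq_right _ _ _
    rw [h1, ← ha, inner_sum]
    simp [inner_smul_right, he]
  · have h1 : ‖U.starProjection (hf.toLp f)‖ ^ 2 ≤ ‖hf.toLp f‖ ^ 2 := by
      gcongr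
      exact Submodule.norm_starProjection_apply_le _ _
    have h2 : ‖hf.toLp f‖ ^ 2 = ∫ x, f x ^ 2 := by
      rw [← real_inner_self_eq_norm_sq, L2.inner_def]
      refine integral_congr_ae ?_
      filter_upwards [hf.coeFn_toLp] with x hx
      simp [hx, sq]
    rw [h2, ← real_inner_self_eq_norm_sq, ← ha, sum_inner] at h1
    refine le_of_eq_of_le ?_ h1
    refine Finset.sum_congr rfl fun s _ ↦ ?_
    rw [inner_sum]
    refine Finset.sum_congr rfl fun t _ ↦ ?_
    rw [inner_smul_left, inner_smul_right, he]
    simp [mul_assoc]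

lemma measurable_whiteNoisePath {Ω : Type*} [MeasurableSpace Ω] {W : ℝ≥0 → Ω → ℝ}
    (hm : ∀ t, Measurable (W t)) (n : ℕ) (f : ℝ → ℝ) : Measurable (whiteNoisePath W n f) :=
  measurable_pi_lambda _ fun _ ↦ ((hm _).const_mul _).const_add _

/-- A chi-square type bound that holds on an algebra of sets generating the σ-algebra holds for all
measurable sets. -/
lemma sq_measure_le_of_isSetAlgebra {α : Type*} [m : MeasurableSpace α] {μ ν : Measure α}
    [IsFiniteMeasure μ] [IsFiniteMeasure ν] {𝒜 : Set (Set α)} (h𝒜 : IsSetAlgebra 𝒜)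
    (hgen : m = MeasurableSpace.generateFrom 𝒜) {K : ℝ}
    (h : ∀ s ∈ 𝒜, ν.real s ^ 2 ≤ K * μ.real s) {s : Set α} (hs : MeasurableSet s) :
    ν.real s ^ 2 ≤ K * μ.real s := by
  -- Approximating under `μ + ν` makes one sequence of sets work for both measures.
  have hd := Measure.MeasureDense.of_generateFrom_isSetAlgebra_finite (μ + ν) h𝒜 hgen
  have hex : ∀ k : ℕ, ∃ t ∈ 𝒜, (μ + ν) (symmDiff s t) < ENNReal.ofReal (1 / (k + 1 : ℝ)) :=
    fun k ↦ hd.approx s hs (measure_ne_top _ _) _ Nat.one_div_pos_of_nat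
  choose t ht htk using hex
  have key : ∀ (ρ : Measure α) [IsFiniteMeasure ρ], ρ ≤ μ + ν →
      Filter.Tendsto (fun k ↦ ρ.real (t k)) Filter.atTop (nhds (ρ.real s)) := by
    intro ρ _ hρ
    rw [tendsto_iff_dist_tendsto_zero]
    refine squeeze_zero (fun _ ↦ dist_nonneg) (fun k ↦ ?_)
      tendsto_one_div_add_atTop_nhds_zero_nat
    have h1 : ρ.real (symmDiff s (t k)) ≤ 1 / (k + 1 : ℝ) :=
      ENNReal.toReal_le_of_le_ofReal (by positivity) ((hρ _).trans (htk k).le)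
    rw [dist_comm, Real.dist_eq]
    exact (abs_measureReal_sub_le_measureReal_symmDiff hs.nullMeasurableSet
      (hd.measurable _ (ht k)).nullMeasurableSet).trans h1
  exact le_of_tendsto_of_tendsto' ((key ν (Measure.le_add_left le_rfl)).pow 2)
    ((key μ (Measure.le_add_right le_rfl)).const_mul K) fun k ↦ h _ (ht k)

/-- The white noise law with drift `f` is dominated, in a chi-square sense, by the law without
drift. -/
lemma whiteNoiseLaw_sq_le {Ω : Type*} [MeasurableSpace Ω] {P : Measure Ω} [IsProbabilityMeasure P]
    {W : ℝ≥0 → Ω → ℝ} (hm : ∀ t, Measurable (W t)) (hW : IsPreBrownianReal W P) {n : ℕ}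
    (hn : 0 < n) {f : ℝ → ℝ} (hf : MemLp f 2 volume) {S : Set (Set.Icc (0 : ℝ) 1 → ℝ)}
    (hS : MeasurableSet S) :
    (whiteNoiseLaw P W n f).real S ^ 2 ≤
      Real.exp (n * ∫ x, f x ^ 2) * (whiteNoiseLaw P W n 0).real S := by
  have hpm := measurable_whiteNoisePath hm n
  have hprob : ∀ g, IsProbabilityMeasure (whiteNoiseLaw P W n g) := fun _ ↦
    Measure.isProbabilityMeasure_map (hpm _).aemeasurable
  refine sq_measure_le_of_isSetAlgebra isSetAlgebra_measurableCylinders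
    generateFrom_measurableCylinders.symm (fun S hS ↦ ?_) hS
  obtain ⟨J, S, hSm, rfl⟩ := (mem_measurableCylinders _).1 hS
  have hσ : 0 < (n : ℝ) ^ (1 / 2 : ℝ) := by positivity
  set σ : ℝ := (n : ℝ) ^ (1 / 2 : ℝ) with hσdef
  have hσi : (n : ℝ) ^ (-(1 / 2) : ℝ) = σ⁻¹ := Real.rpow_neg (by positivity) _
  have hσ2 : σ ^ 2 = n := by
    rw [hσdef, ← Real.rpow_two, ← Real.rpow_mul (by positivity)]
    norm_num
  -- Multiplying the path by `σ = √n` gives unit noise and drift `σ f`, hence the projection of `σ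
  -- f`.
  obtain ⟨a, ha, hav⟩ := exists_sum_min_eq_integral (hf.const_mul σ) J
  let B : Set.Icc (0 : ℝ) 1 → Ω → ℝ := fun t ↦ W ⟨t, t.2.1⟩
  have hB : IsGaussianProcess B P :=
    hW.isGaussianProcess.comp_right fun t : Set.Icc (0 : ℝ) 1 ↦ (⟨t, t.2.1⟩ : ℝ≥0)
  have hBL2 t : MemLp (B t) 2 P := (hB.hasGaussianLaw_eval t).memLp_two
  have hcov s t : cov[B s, B t; P] = min (s : ℝ) t :=
    (hW.covariance_eval ⟨s, s.2.1⟩ ⟨t, t.2.1⟩).trans (NNReal.coe_min _ _)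
  have hcovZ : ∀ s ∈ J, cov[B s, fun ω ↦ ∑ t ∈ J, a t * B t ω; P] =
      σ * ∫ x in (0 : ℝ)..s, f x := by
    intro s hs
    rw [covariance_fun_sum_right' (fun t _ ↦ (hBL2 t).const_mul _) (hBL2 s)]
    simp_rw [covariance_const_mul_right, hcov]
    rw [ha s hs, intervalIntegral.integral_const_mul]
  have hvar : Var[fun ω ↦ ∑ t ∈ J, a t * B t ω; P] ≤ n * ∫ x, f x ^ 2 := by
    have hZm : Measurable fun ω ↦ ∑ t ∈ J, a t * B t ω := by fun_prop
    rw [← covariance_self hZm.aemeasurable, covariance_fun_sum_fun_sum'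
      (fun t _ ↦ (hBL2 t).const_mul _) (fun t _ ↦ (hBL2 t).const_mul _)]
    simp_rw [covariance_const_mul_right, covariance_const_mul_left, hcov]
    simp_rw [mul_pow, integral_const_mul, hσ2] at hav
    refine le_of_eq_of_le ?_ hav
    refine Finset.sum_congr rfl fun s _ ↦ Finset.sum_congr rfl fun t _ ↦ by ring
  let D : Set (Set.Icc (0 : ℝ) 1 → ℝ) := {y | (fun x : J ↦ σ⁻¹ * y x) ∈ S}
  have hDm : MeasurableSet D :=
    (by fun_prop : Measurable fun (y : Set.Icc (0 : ℝ) 1 → ℝ) (x : J) ↦ σ⁻¹ * y x) hSm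
  have key := hB.sq_measure_shift_le (fun t ↦ hm _) (fun t ↦ hW.integral_eval _) J a hDm
  set Y : Set (Set.Icc (0 : ℝ) 1 → ℝ) := cylinder J S with hY
  have hcyl : MeasurableSet Y := MeasurableSet.of_mem_measurableCylinders hS
  have e0 : whiteNoiseLaw P W n 0 Y = P {ω | (fun s ↦ B s ω) ∈ D} := by
    rw [whiteNoiseLaw, Measure.map_apply (hpm 0) hcyl]
    congr 1
    ext ω
    simp only [hY, Set.mem_preimage, mem_cylinder, Set.mem_ofPred_eq, D]
    congr! 2 with s
    simp only [Finset.restrict, whiteNoisePath, B, hσi]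
    simp
  have e1 : whiteNoiseLaw P W n f Y =
      P {ω | (fun s ↦ B s ω + cov[B s, fun ω ↦ ∑ t ∈ J, a t * B t ω; P]) ∈ D} := by
    rw [whiteNoiseLaw, Measure.map_apply (hpm f) hcyl]
    congr 1
    ext ω
    simp only [hY, Set.mem_preimage, mem_cylinder, Set.mem_ofPred_eq, D]
    congr! 2 with s
    rw [hcovZ s s.2]
    simp only [Finset.restrict, whiteNoisePath, B, hσi]
    field_simp
    ring
  rw [← e0, ← e1] at key
  have key' := ENNReal.toReal_mono (by finiteness) key
  rw [ENNReal.toReal_pow, ENNReal.toReal_mul, ENNReal.toReal_ofReal (Real.exp_pos _).le] at key'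
  refine key'.trans ?_
  simp only [measureReal_def]
  gcongr

/-! ### Two-point inequality -/

/-- If `μ₁` is dominated by `μ₀` in a chi-square sense, then a statistic cannot have small mean
absolute deviation from two distant centres under both measures. -/
lemma le_max_meanAbsDev {S : Type*} [MeasurableSpace S] {μ₀ μ₁ : Measure S}
    [IsProbabilityMeasure μ₀] [IsProbabilityMeasure μ₁] {K : ℝ} (hK : 1 ≤ K)
    (h : ∀ A, MeasurableSet A → μ₁.real A ^ 2 ≤ K * μ₀.real A) {T : S → ℝ} (hT : Measurable T)
    (u₀ u₁ : ℝ) :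
    ENNReal.ofReal (|u₁ - u₀| / (8 * K)) ≤ max (meanAbsDev μ₀ T u₀) (meanAbsDev μ₁ T u₁) := by
  set d := |u₁ - u₀| with hd
  have hd0 : 0 ≤ d := abs_nonneg _
  have markov : ∀ (μ : Measure S) [IsProbabilityMeasure μ] (u : ℝ) (A : Set S),
      MeasurableSet A → (∀ y ∈ A, d / 2 ≤ |T y - u|) → 1 / (4 * K) ≤ μ.real A →
      ENNReal.ofReal (d / (8 * K)) ≤ meanAbsDev μ T u := by
    intro μ _ u A hA hAd hμ
    calc ENNReal.ofReal (d / (8 * K)) = ENNReal.ofReal (d / 2 * (1 / (4 * K))) := by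
          congr 1
          field_simp
          ring
      _ ≤ ENNReal.ofReal (d / 2 * μ.real A) := by gcongr
      _ = ENNReal.ofReal (d / 2) * μ A := by
          rw [ENNReal.ofReal_mul (by positivity), ofReal_measureReal]
      _ = ∫⁻ _ in A, ENNReal.ofReal (d / 2) ∂μ := by simp
      _ ≤ ∫⁻ y in A, ENNReal.ofReal |T y - u| ∂μ :=
          setLIntegral_mono' hA fun y hy ↦ ENNReal.ofReal_le_ofReal (hAd y hy)
      _ ≤ _ := setLIntegral_le_lintegral _ _
  let A : Set S := {y | |T y - u₁| < d / 2}
  have hA : MeasurableSet A := measurableSet_lt (by fun_prop) measurable_const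
  rcases le_total (1 / 2) (μ₁.real A) with h1 | h1
  -- Here `μ₀ A ≥ (1/2)² / K`, while on `A` the triangle inequality keeps `T` at least `d / 2` from
  -- `u₀`.
  · refine le_max_of_le_left (markov μ₀ u₀ A hA (fun y hy ↦ ?_) ?_)
    · have hy' : |T y - u₁| < d / 2 := hy
      have : d ≤ |T y - u₁| + |T y - u₀| := by
        rw [hd, abs_sub_comm (T y) u₁]
        exact (abs_sub_le u₁ (T y) u₀)
      linarith
    · rw [div_le_iff₀ (by positivity)]
      nlinarith [h A hA]
  · refine le_max_of_le_right (markov μ₁ u₁ Aᶜ hA.compl (fun y hy ↦ not_lt.1 hy) ?_)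
    rw [probReal_compl_eq_one_sub hA]
    have : 1 / (4 * K) ≤ 1 / 4 := by
      rw [div_le_div_iff₀ (by positivity) (by norm_num)]
      linarith
    linarith

/-! ### Rescaled bumps in the Hölder ball -/

lemma strictFloor_lt {β : ℝ} (hβ : 0 < β) : (strictFloor β : ℝ) < β := by
  have h := Nat.ceil_lt_add_one hβ.le
  have h1 : 1 ≤ ⌈β⌉₊ := Nat.one_le_iff_ne_zero.2 (Nat.ceil_pos.2 hβ).ne'
  rw [strictFloor, Nat.cast_sub h1]
  push_cast
  linarith

lemma le_strictFloor_add_one {β : ℝ} (hβ : 0 < β) : β ≤ strictFloor β + 1 := by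
  have h := Nat.le_ceil β
  have h1 : 1 ≤ ⌈β⌉₊ := Nat.one_le_iff_ne_zero.2 (Nat.ceil_pos.2 hβ).ne'
  rw [strictFloor, Nat.cast_sub h1]
  push_cast
  linarith

lemma HasCompactSupport.iteratedDeriv {φ : ℝ → ℝ} (hφ : HasCompactSupport φ) (l : ℕ) :
    HasCompactSupport (iteratedDeriv l φ) := by
  induction l with
  | zero => simpa using hφ
  | succ l ih => rw [iteratedDeriv_succ]; exact ih.deriv

lemma exists_forall_abs_iteratedDeriv_le {φ : ℝ → ℝ} (hφ : ContDiff ℝ (⊤ : ℕ∞) φ)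
    (hc : HasCompactSupport φ) (k : ℕ) :
    ∃ M : ℝ, 0 < M ∧ ∀ l ≤ k, ∀ x, |iteratedDeriv l φ x| ≤ M := by
  have h : ∀ l, ∃ M : ℝ, ∀ x, ‖iteratedDeriv l φ x‖ ≤ M := fun l ↦
    (hφ.continuous_iteratedDeriv l (by exact_mod_cast le_top)).bounded_above_of_compact_support
      (hc.iteratedDeriv l)
  choose M hM using h
  have hM0 l : 0 ≤ M l := (norm_nonneg _).trans (hM l 0)
  refine ⟨∑ l ∈ Finset.range (k + 1), M l + 1, ?_, fun l hl x ↦ ?_⟩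
  · have := Finset.sum_nonneg fun l (_ : l ∈ Finset.range (k + 1)) ↦ hM0 l
    linarith
  · have := Finset.single_le_sum (f := M) (fun i _ ↦ hM0 i)
      (Finset.mem_range.2 (Nat.lt_succ_of_le hl))
    have := hM l x
    rw [Real.norm_eq_abs] at this
    linarith

/-- The derivative bound handles `|u - v| ≤ 1`, the sup bound the rest; the latter costs the factor
`2`. -/
lemma abs_sub_le_mul_rpow_of_abs_deriv_le {g : ℝ → ℝ} (hg : Differentiable ℝ g) {M γ : ℝ}
    (h0 : ∀ x, |g x| ≤ M) (h1 : ∀ x, |deriv g x| ≤ M) (hγ0 : 0 < γ) (hγ1 : γ ≤ 1) (u v : ℝ) :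
    |g u - g v| ≤ 2 * M * |u - v| ^ γ := by
  have hM : 0 ≤ M := (abs_nonneg _).trans (h0 0)
  rcases le_total |u - v| 1 with h | h
  · have h2 : |g u - g v| ≤ M * |u - v| := by
      simpa [Real.norm_eq_abs] using Convex.norm_image_sub_le_of_norm_deriv_le
        (s := Set.univ) (fun x _ ↦ hg x) (fun x _ ↦ h1 x) convex_univ
        (Set.mem_univ v) (Set.mem_univ u)
    have h3 : |u - v| ≤ |u - v| ^ γ := by
      simpa using Real.rpow_le_rpow_of_exponent_ge' (abs_nonneg (u - v)) h hγ0.le hγ1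
    nlinarith [mul_le_mul_of_nonneg_left h3 hM, Real.rpow_nonneg (abs_nonneg (u - v)) γ]
  · have h2 := abs_sub (g u) (g v)
    have h3 := Real.one_le_rpow h hγ0.le
    nlinarith [h0 u, h0 v]

/-- The profile `φ` centred at `x₀`, with bandwidth `h` and height `L * h ^ β`. -/
noncomputable def scaledBump (φ : ℝ → ℝ) (β L x₀ h : ℝ) : ℝ → ℝ :=
  fun x ↦ L * h ^ β * φ (h⁻¹ * (x - x₀))

section scaledBump

variable {φ : ℝ → ℝ} {β L x₀ h : ℝ}

lemma contDiff_scaledBump {n : WithTop ℕ∞} (hφ : ContDiff ℝ n φ) :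
    ContDiff ℝ n (scaledBump φ β L x₀ h) := by
  unfold scaledBump
  fun_prop

lemma iteratedDeriv_scaledBump (hφ : ContDiff ℝ (⊤ : ℕ∞) φ) (hh : 0 < h) (l : ℕ) (x : ℝ) :
    iteratedDeriv l (scaledBump φ β L x₀ h) x =
      L * h ^ (β - l) * iteratedDeriv l φ (h⁻¹ * (x - x₀)) := by
  have h1 := iteratedDeriv_comp_sub_const l (fun x ↦ φ (h⁻¹ * x)) x₀
  unfold scaledBump
  rw [iteratedDeriv_const_mul_field, h1,
    iteratedDeriv_comp_const_mul (hφ.of_le (by exact_mod_cast le_top)), Real.rpow_sub hh,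
    Real.rpow_natCast, inv_pow]
  ring

/-- The powers of `h` are at most `1` in the sup-norms and cancel exactly in the seminorm. The `k +
1` sup-norms contribute `L * M` each and the seminorm `2 * (L * M)`, whence `k + 3`. -/
lemma scaledBump_mem_holderBall (hφ : ContDiff ℝ (⊤ : ℕ∞) φ) {M R : ℝ} (hβ : 0 < β) (hL : 0 < L)
    (hM : ∀ l ≤ strictFloor β + 1, ∀ x, |iteratedDeriv l φ x| ≤ M)
    (hR : (strictFloor β + 3) * (L * M) ≤ R) (hh : 0 < h) (hh1 : h ≤ 1) :
    scaledBump φ β L x₀ h ∈ holderBall β R := by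
  have hf := contDiff_scaledBump (β := β) (L := L) (x₀ := x₀) (h := h) hφ
  refine ⟨(hf.of_le (by exact_mod_cast le_top)).contDiffOn, ?_⟩
  set k := strictFloor β with hk
  have hkβ : (k : ℝ) < β := strictFloor_lt hβ
  have hβk : β ≤ k + 1 := le_strictFloor_add_one hβ
  have hM0 : 0 ≤ M := (abs_nonneg _).trans (hM 0 (by simp) 0)
  have hD : ∀ l : ℕ, ∀ x ∈ Set.Icc (0 : ℝ) 1,
      iteratedDerivWithin l (scaledBump φ β L x₀ h) (Set.Icc 0 1) x =
      L * h ^ (β - l) * iteratedDeriv l φ (h⁻¹ * (x - x₀)) := fun l x hx ↦ by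
    rw [iteratedDerivWithin_eq_iteratedDeriv (uniqueDiffOn_Icc zero_lt_one)
      (hf.of_le (by exact_mod_cast le_top)).contDiffAt hx, iteratedDeriv_scaledBump hφ hh]
  have hsum : ∀ l ∈ Finset.range (k + 1), (⨆ x ∈ Set.Icc (0 : ℝ) 1, ENNReal.ofReal
      |iteratedDerivWithin l (scaledBump φ β L x₀ h) (Set.Icc 0 1) x|) ≤
        ENNReal.ofReal (L * M) := by
    intro l hl
    have hl' : l ≤ k := Nat.lt_succ_iff.1 (Finset.mem_range.1 hl)
    refine iSup₂_le fun x hx ↦ ENNReal.ofReal_le_ofReal ?_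
    have hp : h ^ (β - l) ≤ 1 := Real.rpow_le_one hh.le hh1 (by
      have : (l : ℝ) ≤ k := by exact_mod_cast hl'
      linarith)
    rw [hD l x hx, abs_mul, abs_of_nonneg (by positivity)]
    calc L * h ^ (β - l) * |iteratedDeriv l φ (h⁻¹ * (x - x₀))| ≤ L * 1 * M := by
          gcongr
          exact hM l (by omega) _
      _ = L * M := by ring
  have hsemi : (⨆ x ∈ Set.Icc (0 : ℝ) 1, ⨆ y ∈ Set.Icc (0 : ℝ) 1, ⨆ _ : x ≠ y,
      ENNReal.ofReal (|iteratedDerivWithin k (scaledBump φ β L x₀ h) (Set.Icc 0 1) x -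
          iteratedDerivWithin k (scaledBump φ β L x₀ h) (Set.Icc 0 1) y| /
        |x - y| ^ (β - (k : ℝ)))) ≤ ENNReal.ofReal (2 * (L * M)) := by
    refine iSup₂_le fun x hx ↦ iSup₂_le fun y hy ↦ iSup_le fun hxy ↦
      ENNReal.ofReal_le_ofReal ?_
    have hxy' : 0 < |x - y| := abs_pos.2 (sub_ne_zero.2 hxy)
    rw [hD k x hx, hD k y hy, ← mul_sub, abs_mul, abs_of_nonneg (by positivity),
      div_le_iff₀ (by positivity)]
    have hdiff : Differentiable ℝ (iteratedDeriv k φ) :=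
      hφ.differentiable_iteratedDeriv k (by exact_mod_cast WithTop.coe_lt_top _)
    have hb := abs_sub_le_mul_rpow_of_abs_deriv_le hdiff (hM k (by omega))
      (fun x ↦ by rw [← iteratedDeriv_succ]; exact hM (k + 1) le_rfl x)
      (sub_pos.2 hkβ) (by linarith : β - k ≤ 1) (h⁻¹ * (x - x₀)) (h⁻¹ * (y - x₀))
    have he : |h⁻¹ * (x - x₀) - h⁻¹ * (y - x₀)| ^ (β - k) =
        (h ^ (β - k))⁻¹ * |x - y| ^ (β - k) := by
      rw [← mul_sub, abs_mul, abs_of_pos (inv_pos.2 hh), sub_sub_sub_cancel_right,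
        Real.mul_rpow (by positivity) (by positivity), Real.inv_rpow hh.le]
    rw [he] at hb
    have hp : 0 < h ^ (β - k) := by positivity
    calc _ ≤ L * h ^ (β - k) * (2 * M * ((h ^ (β - k))⁻¹ * |x - y| ^ (β - k))) := by gcongr
      _ = _ := by field_simp
  calc holderNorm β (scaledBump φ β L x₀ h)
      ≤ (∑ l ∈ Finset.range (k + 1), ENNReal.ofReal (L * M)) + ENNReal.ofReal (2 * (L * M)) :=
        add_le_add (Finset.sum_le_sum hsum) hsemi
    _ = ENNReal.ofReal ((k + 3) * (L * M)) := by
        rw [Finset.sum_const, Finset.card_range, nsmul_eq_mul, ← ENNReal.ofReal_natCast,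
          ← ENNReal.ofReal_mul (by positivity), ← ENNReal.ofReal_add (by positivity)
            (by positivity)]
        push_cast
        ring_nf
    _ ≤ ENNReal.ofReal R := ENNReal.ofReal_le_ofReal hR

lemma integral_sq_scaledBump (hh : 0 < h) :
    ∫ x, scaledBump φ β L x₀ h x ^ 2 = L ^ 2 * h ^ (2 * β + 1) * ∫ x, φ x ^ 2 := by
  simp only [scaledBump, mul_pow, integral_const_mul]
  rw [integral_sub_right_eq_self (fun x ↦ φ (h⁻¹ * x) ^ 2) x₀,
    Measure.integral_comp_mul_left (fun x ↦ φ x ^ 2) h⁻¹, inv_inv, abs_of_pos hh, smul_eq_mul,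
    Real.rpow_add hh, Real.rpow_one, mul_comm 2 β, Real.rpow_mul hh.le, Real.rpow_two]
  ring

lemma memLp_scaledBump (hφ : Continuous φ) (hc : HasCompactSupport φ) (hh : 0 < h) :
    MemLp (scaledBump φ β L x₀ h) 2 volume := by
  have h1 : MemLp (fun x ↦ φ (h⁻¹ * (x - x₀))) 2 volume := by
    refine Continuous.memLp_of_hasCompactSupport (by fun_prop) ?_
    exact hc.comp_homeomorph
      ((Homeomorph.subRight x₀).trans (Homeomorph.mulLeft₀ h⁻¹ (inv_pos.2 hh).ne'))
  exact h1.const_mul _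

lemma zero_mem_holderBall {R : ℝ} : (0 : ℝ → ℝ) ∈ holderBall β R := by
  refine ⟨contDiffOn_const, ?_⟩
  have hD : ∀ l : ℕ, ∀ x ∈ Set.Icc (0 : ℝ) 1,
      iteratedDerivWithin l (0 : ℝ → ℝ) (Set.Icc 0 1) x = 0 := fun l x hx ↦ by
    change iteratedDerivWithin l (fun _ ↦ (0 : ℝ)) (Set.Icc 0 1) x = 0
    rw [iteratedDerivWithin_eq_iteratedDeriv (uniqueDiffOn_Icc zero_lt_one)
      (contDiff_zero_fun (n := l)).contDiffAt hx]
    simp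
  have : holderNorm β 0 = 0 := by
    unfold holderNorm
    simp +contextual [hD]
  simp [this]

end scaledBump

/-! ### Choice of bandwidth and conclusion -/

/-- The lower bound for the mean absolute deviation around any centring that is close to the
estimated value on the whole Hölder ball. -/
lemma exists_le_iSup_meanAbsDev {β R C : ℝ} (hβ : 0 < β) (hR : 0 < R) (hC : 0 < C) :
    ∃ c : ℝ, 0 < c ∧ ∃ N : ℕ, 0 < N ∧
      ∀ n : ℕ, N ≤ n →
      ∀ (Ω : Type*) [MeasurableSpace Ω] (P : Measure Ω) [IsProbabilityMeasure P]
        (W : ℝ≥0 → Ω → ℝ), (∀ t, Measurable (W t)) → IsPreBrownianReal W P →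
      ∀ x₀ : ℝ, ∀ T : (Set.Icc (0 : ℝ) 1 → ℝ) → ℝ, Measurable T →
        ∀ m : (ℝ → ℝ) → ℝ,
          (⨆ f ∈ holderBall β R, ENNReal.ofReal |m f - f x₀|)
            < ENNReal.ofReal ((C / n) ^ (β / (2 * β + 1))) →
          ENNReal.ofReal (c * (n : ℝ) ^ (-(β / (2 * β + 1)))) ≤
            ⨆ f ∈ holderBall β R, meanAbsDev (whiteNoiseLaw P W n f) T (m f) := by
  set r := β / (2 * β + 1) with hr
  let b : ContDiffBump (0 : ℝ) := ⟨1, 2, by norm_num, by norm_num⟩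
  have hφ : ContDiff ℝ (⊤ : ℕ∞) b := b.contDiff
  have hc : HasCompactSupport b := b.hasCompactSupport
  have hφ0 : b 0 = 1 := b.one_of_mem_closedBall (by simp [b])
  obtain ⟨M, hM0, hM⟩ := exists_forall_abs_iteratedDeriv_le hφ hc (strictFloor β + 1)
  obtain ⟨L, hL, hLR⟩ : ∃ L : ℝ, 0 < L ∧ (strictFloor β + 3) * (L * M) ≤ R :=
    ⟨R / ((strictFloor β + 3) * M), by positivity, le_of_eq (by field_simp)⟩
  -- Peak height in units of `n^(-r)`: two biases of at most `C ^ r` leave a gap of `1`.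
  obtain ⟨A, hA, hAL⟩ : ∃ A : ℝ, 0 < A ∧ L * A ^ β = 2 * C ^ r + 1 := by
    refine ⟨((2 * C ^ r + 1) / L) ^ β⁻¹, by positivity, ?_⟩
    rw [← Real.rpow_mul (by positivity), inv_mul_cancel₀ hβ.ne', Real.rpow_one]
    field_simp
  set I := ∫ x, b x ^ 2 with hI
  have hI0 : 0 ≤ I := integral_nonneg fun x ↦ sq_nonneg _
  set K := Real.exp (L ^ 2 * A ^ (2 * β + 1) * I) with hK
  have hK1 : 1 ≤ K := Real.one_le_exp (by positivity)
  -- This makes the bandwidth at most `1`; the later `N + 1` also ensures `n > 0`.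
  obtain ⟨N, hN⟩ := exists_nat_ge (A ^ (2 * β + 1))
  refine ⟨1 / (8 * K), by positivity, N + 1, by omega, ?_⟩
  intro n hn Ω _ P _ W hWm hW x₀ T hT m hm
  have hn0 : 0 < n := by omega
  have hnR : (0 : ℝ) < n := by exact_mod_cast hn0
  set h := A * (n : ℝ) ^ (-(1 / (2 * β + 1))) with hh
  have hh0 : 0 < h := by positivity
  have hhpow : h ^ (2 * β + 1) = A ^ (2 * β + 1) * (n : ℝ)⁻¹ := by
    rw [hh, Real.mul_rpow hA.le (by positivity), ← Real.rpow_mul hnR.le, ← Real.rpow_neg_one]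
    congr 2
    field_simp
  have hh1 : h ≤ 1 := by
    rw [← Real.rpow_le_rpow_iff hh0.le zero_le_one (by positivity : 0 < 2 * β + 1), hhpow,
      Real.one_rpow, mul_inv_le_iff₀ hnR, one_mul]
    exact hN.trans (by exact_mod_cast (by omega : N ≤ n))
  set f := scaledBump b β L x₀ h with hf
  have hfmem : f ∈ holderBall β R := scaledBump_mem_holderBall hφ hβ hL hM hLR hh0 hh1
  have h0mem : (0 : ℝ → ℝ) ∈ holderBall β R := zero_mem_holderBall
  have hfx : f x₀ = (2 * C ^ r + 1) * (n : ℝ) ^ (-r) := by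
    have : h ^ β = A ^ β * (n : ℝ) ^ (-r) := by
      rw [hh, Real.mul_rpow hA.le (by positivity), ← Real.rpow_mul hnR.le]
      congr 2
      rw [hr]
      ring
    simp only [hf, scaledBump, sub_self, mul_zero, hφ0, mul_one]
    rw [this, ← mul_assoc, hAL]
  have hbias : ∀ g ∈ holderBall β R, |m g - g x₀| < C ^ r * (n : ℝ) ^ (-r) := by
    intro g hg
    have h1 := (le_iSup₂_of_le (f := fun f (_ : f ∈ holderBall β R) ↦
      ENNReal.ofReal |m f - f x₀|) g hg le_rfl).trans_lt hm
    rw [Real.div_rpow hC.le hnR.le, div_eq_mul_inv, ← Real.rpow_neg hnR.le] at h1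
    exact (ENNReal.ofReal_lt_ofReal_iff (by positivity)).1 h1
  have hsep : (n : ℝ) ^ (-r) ≤ |m f - m 0| := by
    have h1 := (abs_lt.1 (hbias f hfmem)).1
    have h2 := (abs_lt.1 (hbias 0 h0mem)).2
    rw [hfx] at h1
    simp only [Pi.zero_apply, sub_zero] at h2
    refine le_trans ?_ (le_abs_self _)
    linarith
  have hpm := measurable_whiteNoisePath hWm n
  have hprob : ∀ g, IsProbabilityMeasure (whiteNoiseLaw P W n g) := fun _ ↦
    Measure.isProbabilityMeasure_map (hpm _).aemeasurable
  have hchi : ∀ S, MeasurableSet S →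
      (whiteNoiseLaw P W n f).real S ^ 2 ≤ K * (whiteNoiseLaw P W n 0).real S := by
    intro S hS
    have h1 := whiteNoiseLaw_sq_le hWm hW hn0 (memLp_scaledBump (β := β) (L := L) (x₀ := x₀)
      hφ.continuous hc hh0) hS
    rw [integral_sq_scaledBump hh0, hhpow, ← hI] at h1
    convert h1 using 3
    field_simp
  have hle : ∀ g ∈ holderBall β R, meanAbsDev (whiteNoiseLaw P W n g) T (m g) ≤
      ⨆ f ∈ holderBall β R, meanAbsDev (whiteNoiseLaw P W n f) T (m f) := fun g hg ↦
    le_iSup₂_of_le (f := fun f (_ : f ∈ holderBall β R) ↦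
      meanAbsDev (whiteNoiseLaw P W n f) T (m f)) g hg le_rfl
  calc _ ≤ ENNReal.ofReal (|m f - m 0| / (8 * K)) := by
        refine ENNReal.ofReal_le_ofReal ?_
        rw [one_div_mul_eq_div]
        gcongr
    _ ≤ _ := le_max_meanAbsDev hK1 hchi hT _ _
    _ ≤ _ := max_le (hle 0 h0mem) (hle f hfmem)

theorem theorem7p2 (β R C : ℝ) (hβ : 0 < β) (hR : 0 < R) (hC : 0 < C) :
    ∃ c : ℝ, 0 < c ∧ ∃ N : ℕ, 0 < N ∧
      ∀ n : ℕ, N ≤ n →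
      ∀ (Ω : Type*) [MeasurableSpace Ω] (P : Measure Ω) [IsProbabilityMeasure P]
        (W : ℝ≥0 → Ω → ℝ), (∀ t, Measurable (W t)) → IsBrownianReal W P →
      ∀ x₀ ∈ Set.Icc (0 : ℝ) 1,
      ∀ T : (Set.Icc (0 : ℝ) 1 → ℝ) → ℝ, Measurable T →
        -- centring at the mean
        ((∀ f ∈ holderBall β R, Integrable T (whiteNoiseLaw P W n f)) →
          (⨆ f ∈ holderBall β R,
              ENNReal.ofReal |bias (whiteNoiseLaw P W n f) T (f x₀)|)
            < ENNReal.ofReal ((C / n) ^ (β / (2 * β + 1))) →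
          ENNReal.ofReal (c * (n : ℝ) ^ (-(β / (2 * β + 1)))) ≤
            ⨆ f ∈ holderBall β R,
              meanAbsDev (whiteNoiseLaw P W n f) T (∫ y, T y ∂(whiteNoiseLaw P W n f))) ∧
        -- centring at the median, for every choice of medians
        (∀ m : (ℝ → ℝ) → ℝ,
          (∀ f ∈ holderBall β R, IsMedian (whiteNoiseLaw P W n f) T (m f)) →
          (⨆ f ∈ holderBall β R, ENNReal.ofReal |m f - f x₀|)
            < ENNReal.ofReal ((C / n) ^ (β / (2 * β + 1))) →
          ENNReal.ofReal (c * (n : ℝ) ^ (-(β / (2 * β + 1)))) ≤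
            ⨆ f ∈ holderBall β R, meanAbsDev (whiteNoiseLaw P W n f) T (m f)) := by

  obtain ⟨c, hc, N, hN, h⟩ := exists_le_iSup_meanAbsDev hβ hR hC
  refine ⟨c, hc, N, hN, fun n hn Ω _ P _ W hWm hW x₀ _ T hT ↦ ⟨fun _ hbias ↦ ?_, fun m _ hm ↦ ?_⟩⟩
  · exact h n hn Ω P W hWm hW.toIsPreBrownianReal x₀ T hT
      (fun f ↦ ∫ y, T y ∂(whiteNoiseLaw P W n f)) hbias
  · exact h n hn Ω P W hWm hW.toIsPreBrownianReal x₀ T hT m hm
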